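/- Let $E$ be a uniformly convex (real) Banach space whose norm is Fréchet differentiable, i.e. for each $x\in E$ with $\|x\|=1$ the limit $\lim_{t\to 0}(\|x+ty\|-\|x\|)/t$ exists and is attained uniformly in $y\in E$ with $\|y\|=1$. Let $\tau$ be a Hausdorff topology on $E$ (not necessarily related to the norm), and let $C$ be a bounded closed convex subset of $E$. Let $\{T(t):t\ge 0\}$ be a one-parameter $\tau$-continuous semigroup of nonexpansive mappings on $C$; that is, each $T(t)$ maps $C$ into $C$ and satisfies $\|T(t)x-T(t)y\|\le\|x-y\|$ for all $x,y\in C$; $T(s+t)=T(s)\circ T(t)$ for all $s,t\ge 0$; and for each $x\in C$ the map $t\mapsto T(t)x$ from $[0,\infty)$ into $C$ is continuous with respect to $\tau$. Fix $\alpha,\beta>0$ with $\alpha/\beta\notin\mathbb{Q}$ and $\kappa,\lambda>0$ with $\kappa+\lambda<1$. Define a sequence $\{x_n\}$ in $C$ by choosing $x_1\in C$ arbitrarily and setting $$x_{n+1}=\kappa\,T(\alpha)x_n+\lambda\,T(\beta)x_n+(1-\kappa-\lambda)\,x_n\qquad(n=1,2,\dots).$$ Then $\{x_n\}$ converges weakly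 to a common fixed point of $\{T(t):t\ge 0\}$, i.e. to some $z\in C$ with $T(t)z=z$ for all $t\ge 0$. -/

import Mathlib

open Filter Topology
open scoped NNReal

/-- The norm of `E` is Fréchet differentiable: for each unit vector `x`, the limit
`lim_{t → 0} (‖x + t y‖ - ‖x‖) / t` exists and is attained uniformly in unit vectors `y`. -/
def FrechetDifferentiableNorm (E : Type*) [NormedAddCommGroup E] [NormedSpace ℝ E] : Prop :=
  ∀ x : E, ‖x‖ = 1 → ∃ g : E → ℝ,
    TendstoUniformlyOn (fun (t : ℝ) (y : E) => (‖x + t • y‖ - ‖x‖) / t) g (𝓝[≠] 0)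
      {y : E | ‖y‖ = 1}

/-- `{T(t) : t ≥ 0}` is a one-parameter `τ`-continuous semigroup of nonexpansive mappings on the
subset `C` of `E`. Here `τ` is a topology on `E` unrelated to the norm topology, and no condition
is imposed on `T(0)` beyond the semigroup law. -/
structure IsNonexpansiveSemigroup {E : Type*} [NormedAddCommGroup E] (τ : TopologicalSpace E)
    (C : Set E) (T : ℝ≥0 → C → C) : Prop where
  map_add : ∀ s t : ℝ≥0, T (s + t) = T s ∘ T t
  continuous_orbit : ∀ x : C, @Continuous ℝ≥0 E _ τ (fun t => (T t x : E))
  nonexpansive : ∀ (t : ℝ≥0) (x y : C), ‖(T t x : E) - (T t y : E)‖ ≤ ‖(x : E) - (y : E)‖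

/-- The sequence `x` converges to `z` in the weak topology of the normed space `E`. -/
def WeaklyConverges {E : Type*} [NormedAddCommGroup E] [NormedSpace ℝ E]
    (x : ℕ → E) (z : E) : Prop :=
  Tendsto (fun n => toWeakSpace ℝ E (x n)) atTop (𝓝 (toWeakSpace ℝ E z))

/-! Put S = κT(α) + λT(β) + (1-κ-λ)I, a nonexpansive map with x_{n+1} = S x_n. The asymptotic centre
of an orbit is a common fixed point p of the semigroup (`exists_common_fixedPoint_of_semigroup`).
Measured from p, uniform convexity gives x_n - S x_n → 0 (`tendsto_norm_sub_of_combo`), and strict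
convexity forces every fixed point of S to be fixed by T(α) and T(β) (`eq_of_combo_eq_self`).

Weak subsequential limits of x_n exist and are fixed by S (`WeaklyConverges.map_eq_self`). Their
uniqueness is where the smoothness of the norm enters: for fixed points p, q of S, Bruck's
inequality makes ‖t x_n + (1-t)p - q‖ converge for each t in (0,1). Expanding the norm at p - q for
small t, two weak limits p ≠ q would produce two different limits.

Finally, the nonnegative elements of ℤα + ℤβ fix the weak limit z and are dense in [0,∞), and the
times fixing z form a closed set because τ is Hausdorff. -/

/-! ### Quantitative uniform convexity and nested convex sets. -/

section UniformConvexity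

variable {E : Type*} [NormedAddCommGroup E] [NormedSpace ℝ E]

/-- Split off as much of a + b as possible and bound the remaining multiple of a or b trivially. The
loss is 2 min(s, 1-s) c, which is at least 2s(1-s)c. -/
theorem norm_combo_le_of_norm_add_le {a b : E} {d c : ℝ} (hc : 0 ≤ c) (ha : ‖a‖ ≤ d) (hb : ‖b‖ ≤ d)
    (hab : ‖a + b‖ ≤ 2 * (d - c)) {s : ℝ} (h0 : 0 ≤ s) (h1 : s ≤ 1) :
    ‖(1 - s) • a + s • b‖ ≤ d - 2 * (s * (1 - s)) * c := by
  have hs2 : 0 ≤ s * s * c := by positivity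
  have ht2 : 0 ≤ (1 - s) * (1 - s) * c := mul_nonneg (mul_self_nonneg _) hc
  rcases le_total s (1 / 2) with hs | hs
  · have e : (1 - s) • a + s • b = s • (a + b) + (1 - 2 * s) • a := by module
    have h2 : 0 ≤ 1 - 2 * s := by linarith
    rw [e]
    refine (norm_add_le _ _).trans ?_
    rw [norm_smul_of_nonneg h0, norm_smul_of_nonneg h2]
    have i1 := mul_le_mul_of_nonneg_left hab h0
    have i2 := mul_le_mul_of_nonneg_left ha h2
    nlinarith
  · have e : (1 - s) • a + s • b = (1 - s) • (a + b) + (2 * s - 1) • b := by module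
    have h2 : 0 ≤ 2 * s - 1 := by linarith
    have h3 : 0 ≤ 1 - s := by linarith
    rw [e]
    refine (norm_add_le _ _).trans ?_
    rw [norm_smul_of_nonneg h3, norm_smul_of_nonneg h2]
    have i1 := mul_le_mul_of_nonneg_left hab h3
    have i2 := mul_le_mul_of_nonneg_left hb h2
    nlinarith

/-- Uniform convexity for convex combinations with arbitrary weights, uniformly over balls of
radius at most `D`. -/
theorem exists_pos_norm_combo_le (E : Type*) [NormedAddCommGroup E] [NormedSpace ℝ E]
    [UniformConvexSpace E] (D : ℝ) {η : ℝ} (hη : 0 < η) :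
    ∃ c > 0, ∀ d ≤ D, ∀ a b : E, ‖a‖ ≤ d → ‖b‖ ≤ d → η ≤ ‖a - b‖ →
      ∀ s : ℝ, 0 ≤ s → s ≤ 1 → ‖(1 - s) • a + s • b‖ ≤ d - 2 * (s * (1 - s)) * c := by
  have hD' : 0 < max D 1 := lt_max_of_lt_right one_pos
  obtain ⟨δ, hδ, h⟩ := exists_forall_closed_ball_dist_add_le_two_sub E (div_pos hη hD')
  -- After rescaling by d, ‖a + b‖ falls short of 2d by dδ, and d ≥ η/2 because ‖a - b‖ ≥ η.
  refine ⟨η * δ / 4, by positivity, fun d hd a b ha hb hab s h0 h1 => ?_⟩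
  have hdη : η ≤ 2 * d := by linarith [norm_sub_le a b]
  have hd0 : 0 < d := by linarith
  refine norm_combo_le_of_norm_add_le (by positivity) ha hb ?_ h0 h1
  have hi : 0 ≤ d⁻¹ := by positivity
  have key := h (x := d⁻¹ • a) (by
      rw [norm_smul_of_nonneg hi, inv_mul_le_iff₀ hd0]; simpa using ha) (y := d⁻¹ • b) (by
      rw [norm_smul_of_nonneg hi, inv_mul_le_iff₀ hd0]; simpa using hb) (by
      rw [← smul_sub, norm_smul_of_nonneg hi, div_eq_inv_mul]
      exact mul_le_mul (inv_anti₀ hd0 (hd.trans (le_max_left _ _))) hab hη.le hi)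
  rw [← smul_add, norm_smul_of_nonneg hi, inv_mul_le_iff₀ hd0] at key
  nlinarith

/-- Almost shortest vectors are close to each other as soon as their midpoint is not much
shorter. -/
theorem exists_pos_norm_sub_lt (E : Type*) [NormedAddCommGroup E] [NormedSpace ℝ E]
    [UniformConvexSpace E] (R : ℝ) {η : ℝ} (hη : 0 < η) :
    ∃ δ > 0, ∀ a b : E, ‖a‖ ≤ R + δ → ‖b‖ ≤ R + δ →
      R - δ ≤ ‖(1 / 2 : ℝ) • a + (1 / 2 : ℝ) • b‖ → ‖a - b‖ < η := by
  obtain ⟨c, hc, h⟩ := exists_pos_norm_combo_le E (R + 1) hη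
  refine ⟨min 1 (c / 8), by positivity, fun a b ha hb hab => ?_⟩
  by_contra! hcon
  have h1 := min_le_left 1 (c / 8)
  have h2 := min_le_right 1 (c / 8)
  have := h (R + min 1 (c / 8)) (by linarith) a b ha hb hcon (1 / 2) (by norm_num) (by norm_num)
  norm_num at this hab
  linarith

variable [UniformConvexSpace E] [CompleteSpace E]

/-- A decreasing sequence of nonempty bounded closed convex sets in a uniformly convex Banach
space has nonempty intersection. -/
theorem nonempty_iInter_of_antitone_convex (K : ℕ → Set E) (hanti : Antitone K)
    (hne : ∀ n, (K n).Nonempty) (hcl : ∀ n, IsClosed (K n)) (hcx : ∀ n, Convex ℝ (K n))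
    (hb : Bornology.IsBounded (K 0)) : (⋂ n, K n).Nonempty := by
  obtain ⟨M, hM⟩ := hb.exists_norm_le
  set d : ℕ → ℝ := fun n => Metric.infDist 0 (K n) with hd
  have hdle : ∀ n, ∀ y ∈ K n, d n ≤ ‖y‖ := fun n y hy => by
    simpa using Metric.infDist_le_dist_of_mem (x := (0 : E)) hy
  have hdmono : Monotone d := fun m n hmn =>
    Metric.infDist_le_infDist_of_subset (hanti hmn) (hne n)
  have hdbdd : BddAbove (Set.range d) := by
    refine ⟨M, ?_⟩
    rintro _ ⟨n, rfl⟩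
    obtain ⟨y, hy⟩ := hne n
    exact (hdle n y hy).trans (hM y (hanti (Nat.zero_le n) hy))
  set R := ⨆ n, d n
  have hdR : Tendsto d atTop (𝓝 R) := tendsto_atTop_ciSup hdmono hdbdd
  have hex : ∀ n : ℕ, ∃ y ∈ K n, ‖y‖ ≤ R + 1 / ((n : ℝ) + 1) := fun n => by
    have hlt : Metric.infDist 0 (K n) < R + 1 / ((n : ℝ) + 1) := by
      have : (0 : ℝ) < 1 / ((n : ℝ) + 1) := Nat.one_div_pos_of_nat
      have h2 : d n ≤ R := le_ciSup hdbdd n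
      simp only [hd] at h2
      linarith
    obtain ⟨y, hy, hy2⟩ := (Metric.infDist_lt_iff (hne n)).1 hlt
    exact ⟨y, hy, by simpa using hy2.le⟩
  -- Nearly shortest points of the K n: the midpoint of two late ones stays in K N, so its norm is
  -- nearly R, and uniform convexity makes the points Cauchy.
  choose y hyK hy using hex
  have hcau : CauchySeq y := by
    refine Metric.cauchySeq_iff.2 fun η hη => ?_
    obtain ⟨δ, hδ, h⟩ := exists_pos_norm_sub_lt E R hη
    obtain ⟨N, hN⟩ := ((tendsto_one_div_add_atTop_nhds_zero_nat (𝕜 := ℝ)).eventually_lt_const hδ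
      |>.and (hdR.eventually_const_lt (show R - δ < R by linarith))).exists_forall_of_atTop
    refine ⟨N, fun m hm n hn => ?_⟩
    rw [dist_eq_norm]
    refine h _ _ ((hy m).trans ?_) ((hy n).trans ?_) ?_
    · linarith [(hN m hm).1]
    · linarith [(hN n hn).1]
    · refine (hN N le_rfl).2.le.trans (hdle N _ ?_)
      exact hcx N (hanti hm (hyK m)) (hanti hn (hyK n)) (by norm_num) (by norm_num) (by norm_num)
  obtain ⟨z, hz⟩ := cauchySeq_tendsto_of_complete hcau
  refine ⟨z, Set.mem_iInter.2 fun n => (hcl n).mem_of_tendsto hz ?_⟩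
  filter_upwards [eventually_ge_atTop n] with m hm using hanti hm (hyK m)

end UniformConvexity

/-! ### Weak convergence and weak sequential compactness. -/

section WeakConvergence

variable {E : Type*} [NormedAddCommGroup E] [NormedSpace ℝ E]

theorem weaklyConverges_iff {x : ℕ → E} {z : E} :
    WeaklyConverges x z ↔ ∀ f : StrongDual ℝ E, Tendsto (fun n => f (x n)) atTop (𝓝 (f z)) := by
  unfold WeaklyConverges
  constructor
  · intro h f
    exact ((WeakBilin.eval_continuous (topDualPairing ℝ E).flip f).tendsto _).comp h
  · intro h
    exact (Topology.IsInducing.tendsto_nhds_iff ⟨rfl⟩).2 (tendsto_pi_nhds.2 h)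

theorem WeaklyConverges.comp_tendsto {x : ℕ → E} {z : E} (h : WeaklyConverges x z) {φ : ℕ → ℕ}
    (hφ : Tendsto φ atTop atTop) : WeaklyConverges (x ∘ φ) z :=
  (show Tendsto (fun n => toWeakSpace ℝ E (x n)) atTop _ from h).comp hφ

/-- Mazur's lemma. -/
theorem WeaklyConverges.mem_closure_convexHull {x : ℕ → E} {z : E} (h : WeaklyConverges x z)
    (N : ℕ) : z ∈ closure (convexHull ℝ (x '' Set.Ici N)) := by
  by_contra hz
  obtain ⟨f, u, hu, hlt⟩ :=
    geometric_hahn_banach_point_closed (convex_convexHull ℝ _).closure isClosed_closure hz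
  have : u ≤ f z := by
    refine ge_of_tendsto (weaklyConverges_iff.1 h f) ?_
    filter_upwards [eventually_ge_atTop N] with n hn
    exact (hlt _ (subset_closure (subset_convexHull ℝ _ ⟨n, hn, rfl⟩))).le
  linarith

theorem WeaklyConverges.mem_of_isClosed_of_convex {x : ℕ → E} {z : E} (h : WeaklyConverges x z)
    {C : Set E} (hC : IsClosed C) (hCx : Convex ℝ C) (hx : ∀ n, x n ∈ C) : z ∈ C := by
  refine closure_minimal (convexHull_min ?_ hCx) hC (h.mem_closure_convexHull 0)
  rintro _ ⟨n, -, rfl⟩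
  exact hx n

/-- A closed ball around L pulls back to a closed convex set containing a tail, hence the closed
hull of that tail. -/
theorem apply_eq_of_forall_mem_closure_convexHull {x : ℕ → E} {z : E} (f : StrongDual ℝ E) {L : ℝ}
    (hf : Tendsto (fun n => f (x n)) atTop (𝓝 L))
    (hz : ∀ N, z ∈ closure (convexHull ℝ (x '' Set.Ici N))) : f z = L := by
  refine eq_of_forall_dist_le fun ε hε => ?_
  obtain ⟨N, hN⟩ := (Metric.tendsto_atTop.1 hf) ε hε
  have hcl : IsClosed (f ⁻¹' Metric.closedBall L ε) := Metric.isClosed_closedBall.preimage f.continuous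
  have hcx : Convex ℝ (f ⁻¹' Metric.closedBall L ε) :=
    (convex_closedBall L ε).is_linear_preimage f.toLinearMap.isLinear
  refine closure_minimal (convexHull_min ?_ hcx) hcl (hz N)
  rintro _ ⟨n, hn, rfl⟩
  exact (hN n hn).le

/-- A separable set is contained in a set on which countably many functionals detect zero. -/
theorem exists_seq_dual_separating {s : Set E} (hs : TopologicalSpace.IsSeparable s)
    (hne : s.Nonempty) :
    ∃ f : ℕ → StrongDual ℝ E, ∀ y ∈ s, (∀ i, f i y = 0) → y = 0 := by
  obtain ⟨c, hc, hsc⟩ := hs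
  have hcne : c.Nonempty := closure_nonempty_iff.1 (hne.mono hsc)
  obtain ⟨d, rfl⟩ := hc.exists_eq_range hcne
  choose f hf1 hf2 using fun i => exists_dual_vector'' ℝ (d i)
  refine ⟨f, fun y hy h0 => ?_⟩
  rw [← norm_le_zero_iff]
  refine le_of_forall_pos_le_add fun ε hε => ?_
  obtain ⟨_, ⟨i, rfl⟩, hi⟩ := Metric.mem_closure_iff.1 (hsc hy) (ε / 2) (by linarith)
  rw [dist_eq_norm] at hi
  have h1 : ‖d i‖ ≤ ‖y - d i‖ := by
    have e : f i (d i - y) = ‖d i‖ := by rw [map_sub, hf2, h0]; simp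
    have := (f i).le_of_opNorm_le (hf1 i) (d i - y)
    rw [e, norm_sub_rev] at this
    simpa using this
  have h2 : ‖y‖ ≤ ‖y - d i‖ + ‖d i‖ := by simpa using norm_add_le (y - d i) (d i)
  linarith

variable [UniformConvexSpace E] [CompleteSpace E]

/-- Weak sequential compactness of bounded sets in a uniformly convex Banach space. -/
theorem exists_subseq_weaklyConverges (x : ℕ → E) {M : ℝ} (hM : ∀ n, ‖x n‖ ≤ M) :
    ∃ z : E, ∃ φ : ℕ → ℕ, StrictMono φ ∧ WeaklyConverges (x ∘ φ) z := by
  set Y := (Submodule.span ℝ (Set.range x)).topologicalClosure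
  have hYsep : TopologicalSpace.IsSeparable (Y : Set E) :=
    ((Set.countable_range x).isSeparable.span (R := ℝ)).closure
  obtain ⟨f, hf⟩ := exists_seq_dual_separating hYsep ⟨0, Y.zero_mem⟩
  set K : (ℕ → ℕ) → ℕ → Set E := fun ψ N => closure (convexHull ℝ ((x ∘ ψ) '' Set.Ici N)) with hK
  have hKY : ∀ ψ N, K ψ N ⊆ Y := fun ψ N => by
    refine closure_minimal (convexHull_min ?_ Y.convex) (Submodule.isClosed_topologicalClosure _)
    rintro _ ⟨n, -, rfl⟩
    exact Submodule.le_topologicalClosure _ (Submodule.subset_span ⟨_, rfl⟩)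
  have hKne : ∀ ψ, ∃ z, ∀ N, z ∈ K ψ N := fun ψ => by
    have := nonempty_iInter_of_antitone_convex (K ψ)
      (fun m n hmn => closure_mono (convexHull_mono (Set.image_mono (Set.Ici_subset_Ici.2 hmn))))
      (fun n => ⟨x (ψ n), subset_closure (subset_convexHull ℝ _ ⟨n, Set.self_mem_Ici, rfl⟩)⟩)
      (fun n => isClosed_closure) (fun n => (convex_convexHull ℝ _).closure) (by
        refine (Metric.isBounded_closedBall (x := (0 : E)) (r := M)).subset
          (closure_minimal (convexHull_min ?_ (convex_closedBall _ _)) Metric.isClosed_closedBall)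
        rintro _ ⟨n, -, rfl⟩
        simpa using hM (ψ n))
    obtain ⟨z, hz⟩ := this
    exact ⟨z, Set.mem_iInter.1 hz⟩
  have hbd : ∀ (g : StrongDual ℝ E) n, g (x n) ∈ Metric.closedBall (0 : ℝ) (‖g‖ * M) := fun g n => by
    rw [mem_closedBall_zero_iff]
    exact (g.le_opNorm _).trans (mul_le_mul_of_nonneg_left (hM n) (norm_nonneg g))
  -- Diagonal extraction: one subsequence along which every `f i` converges.
  obtain ⟨a, -, φ, hφ, ha⟩ := (isCompact_univ_pi fun i =>
    isCompact_closedBall (0 : ℝ) (‖f i‖ * M)).tendsto_subseq (x := fun n i => f i (x n))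
    (fun n i _ => hbd (f i) n)
  have ha' : ∀ i, Tendsto (fun n => f i (x (φ n))) atTop (𝓝 (a i)) := tendsto_pi_nhds.1 ha
  obtain ⟨z, hz⟩ := hKne φ
  refine ⟨z, φ, hφ, weaklyConverges_iff.2 fun g => tendsto_of_subseq_tendsto fun ns hns => ?_⟩
  obtain ⟨L, -, ms, hms, hL⟩ := tendsto_subseq_of_bounded
    (Metric.isBounded_closedBall (x := (0 : ℝ)) (r := ‖g‖ * M)) (fun n => hbd g (φ (ns n)))
  -- A point w of all tail hulls of the further subsequence has the same `f i` values as z, so w =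
  -- z. Hence L = g w = g z, whichever subsequence was chosen.
  obtain ⟨w, hw⟩ := hKne (φ ∘ ns ∘ ms)
  have hwz : w - z = 0 := by
    refine hf _ (Y.sub_mem (hKY _ _ (hw 0)) (hKY _ _ (hz 0))) fun i => ?_
    rw [map_sub, apply_eq_of_forall_mem_closure_convexHull (f i) (ha' i) hz,
      apply_eq_of_forall_mem_closure_convexHull (f i)
        ((ha' i).comp (hns.comp hms.tendsto_atTop)) hw, sub_self]
  have hgw : g w = L := apply_eq_of_forall_mem_closure_convexHull g hL hw
  rw [sub_eq_zero.1 hwz] at hgw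
  exact ⟨ms, hgw ▸ hL⟩

/-- A bounded sequence all of whose weak subsequential limits coincide converges weakly. -/
theorem weaklyConverges_of_subseq_unique (x : ℕ → E) {M : ℝ} (hM : ∀ n, ‖x n‖ ≤ M) (z : E)
    (h : ∀ w, ∀ φ : ℕ → ℕ, Tendsto φ atTop atTop → WeaklyConverges (x ∘ φ) w → w = z) :
    WeaklyConverges x z := by
  refine tendsto_of_subseq_tendsto fun ns hns => ?_
  obtain ⟨w, φ, hφ, hw⟩ := exists_subseq_weaklyConverges (x ∘ ns) fun n => hM (ns n)
  obtain rfl := h w (ns ∘ φ) (hns.comp hφ.tendsto_atTop) hw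
  exact ⟨φ, hw⟩

end WeakConvergence

/-! ### Bruck's inequality, demiclosedness, asymptotic regularity. -/

section NonexpansiveMappings

variable {E : Type*} [NormedAddCommGroup E] [NormedSpace ℝ E] [UniformConvexSpace E]

/-- Bruck's inequality for two points: a nonexpansive mapping which almost preserves the distance
between two points is almost affine on the segment between them. -/
theorem exists_pos_norm_map_combo_sub_le (E : Type*) [NormedAddCommGroup E] [NormedSpace ℝ E]
    [UniformConvexSpace E] (D : ℝ) {η : ℝ} (hη : 0 < η) :
    ∃ δ > 0, ∀ (C : Set E) (V : C → C), (∀ x y : C, ‖(V x : E) - V y‖ ≤ ‖(x : E) - y‖) →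
      ∀ x y : C, ‖(x : E) - y‖ ≤ D → ‖(x : E) - y‖ - ‖(V x : E) - V y‖ ≤ δ →
      ∀ t : ℝ, 0 < t → t < 1 → ∀ w : C, (w : E) = t • (x : E) + (1 - t) • (y : E) →
        ‖(V w : E) - (t • (V x : E) + (1 - t) • (V y : E))‖ ≤ η := by
  obtain ⟨c, hc, h⟩ := exists_pos_norm_combo_le E D hη
  refine ⟨η * c / (|D| + 1), by positivity, fun C V hV x y hD hxy t ht0 ht1 w hw => ?_⟩
  have hs : 0 < 1 - t := by linarith
  set d := ‖(x : E) - y‖ with hd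
  -- Both a and b have norm at most d, their combination is V x - V y, and the defect of affinity is
  -- t(1-t)(b - a). If a and b are far apart, the loss 2t(1-t)c is at most δ, which makes t(1-t)
  -- small. The bound is therefore uniform in t.
  set a : E := (1 - t)⁻¹ • ((V x : E) - V w) with ha
  set b : E := t⁻¹ • ((V w : E) - V y) with hb
  have ea : (1 - t) • a = (V x : E) - V w := by rw [ha, smul_inv_smul₀ hs.ne']
  have eb : t • b = (V w : E) - V y := by rw [hb, smul_inv_smul₀ ht0.ne']
  have had : ‖a‖ ≤ d := by
    rw [ha, norm_smul_of_nonneg (inv_nonneg.2 hs.le), inv_mul_le_iff₀ hs]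
    refine (hV x w).trans ?_
    rw [hw, show (x : E) - (t • (x : E) + (1 - t) • (y : E)) = (1 - t) • ((x : E) - y) by module,
      norm_smul_of_nonneg hs.le]
  have hbd : ‖b‖ ≤ d := by
    rw [hb, norm_smul_of_nonneg (inv_nonneg.2 ht0.le), inv_mul_le_iff₀ ht0]
    refine (hV w y).trans ?_
    rw [hw, show (t • (x : E) + (1 - t) • (y : E)) - y = t • ((x : E) - y) by module,
      norm_smul_of_nonneg ht0.le]
  have esum : (1 - t) • a + t • b = (V x : E) - V y := by rw [ea, eb]; abel
  have ediff : (V w : E) - (t • (V x : E) + (1 - t) • (V y : E)) = (t * (1 - t)) • (b - a) := by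
    have : (t * (1 - t)) • (b - a) = (1 - t) • (t • b) - t • ((1 - t) • a) := by module
    rw [this, ea, eb]
    module
  have hts : 0 ≤ t * (1 - t) := by positivity
  rw [ediff, norm_smul_of_nonneg hts, norm_sub_rev]
  rcases lt_or_ge ‖a - b‖ η with hlt | hge
  · exact (mul_le_of_le_one_left (norm_nonneg _) (by nlinarith)).trans hlt.le
  · have h1 := h d hD a b had hbd hge t ht0.le ht1.le
    rw [esum] at h1
    have h2 : 2 * (t * (1 - t)) * c ≤ η * c / (|D| + 1) := by linarith
    rw [le_div_iff₀ (by positivity)] at h2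
    have h3 : 2 * (t * (1 - t)) * (|D| + 1) ≤ η := by
      refine le_of_mul_le_mul_right ?_ hc
      linarith
    have h4 : ‖a - b‖ ≤ 2 * (|D| + 1) := by linarith [norm_sub_le a b, le_abs_self D]
    nlinarith

/-- Points on a segment between almost fixed points are almost fixed. -/
theorem exists_pos_almost_fixed_segment {C : Set E} (hCb : Bornology.IsBounded C) {V : C → C}
    (hV : ∀ x y : C, ‖(V x : E) - V y‖ ≤ ‖(x : E) - y‖) {ε : ℝ} (hε : 0 < ε) :
    ∃ δ > 0, δ ≤ ε / 2 ∧ ∀ u v w : C, ‖(u : E) - V u‖ ≤ δ → ‖(v : E) - V v‖ ≤ δ →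
      (w : E) ∈ segment ℝ (u : E) v → ‖(w : E) - V w‖ ≤ ε := by
  obtain ⟨D, hD⟩ := Metric.isBounded_iff.1 hCb
  obtain ⟨δ, hδ, h⟩ := exists_pos_norm_map_combo_sub_le E D (half_pos hε)
  have m1 := min_le_left (δ / 2) (ε / 2)
  have m2 := min_le_right (δ / 2) (ε / 2)
  -- Two displacements of at most δ/2 change ‖u - v‖ by at most δ, as Bruck's inequality requires.
  refine ⟨min (δ / 2) (ε / 2), by positivity, m2, fun u v w hu hv hw => ?_⟩
  obtain ⟨a, b, ha, hb, hab, hw⟩ := hw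
  obtain rfl : b = 1 - a := by linarith
  rcases ha.eq_or_lt with rfl | ha
  · obtain rfl : w = v := by ext; rw [← hw]; module
    linarith
  rcases hb.eq_or_lt with hb0 | hb
  · obtain rfl : w = u := by
      ext
      rw [← hw, ← hb0, show a = 1 by linarith]
      module
    linarith
  have huv : ‖(u : E) - v‖ - ‖(V u : E) - V v‖ ≤ δ := by
    have e : (u : E) - v = ((u : E) - V u) + ((V u : E) - V v) - ((v : E) - V v) := by abel
    have e1 := norm_sub_le (((u : E) - V u) + ((V u : E) - V v)) ((v : E) - V v)
    have e2 := norm_add_le ((u : E) - V u) ((V u : E) - V v)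
    rw [← e] at e1
    linarith
  have hDuv : ‖(u : E) - v‖ ≤ D := by simpa [dist_eq_norm] using hD u.2 v.2
  have key := h C V hV u v hDuv huv a ha (by linarith) w hw.symm
  have e : (w : E) - V w = (a • ((u : E) - V u) + (1 - a) • ((v : E) - V v))
      - ((V w : E) - (a • (V u : E) + (1 - a) • (V v : E))) := by
    rw [← hw]; module
  rw [e]
  refine (norm_sub_le _ _).trans ?_
  have e2 : ‖a • ((u : E) - V u) + (1 - a) • ((v : E) - V v)‖ ≤ ε / 2 := by
    refine (norm_add_le _ _).trans ?_
    rw [norm_smul_of_nonneg ha.le, norm_smul_of_nonneg hb.le]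
    nlinarith
  linarith

/-- Browder's demiclosedness principle. -/
theorem WeaklyConverges.map_eq_self {C : Set E} (hCb : Bornology.IsBounded C)
    (hCx : Convex ℝ C) {V : C → C} (hV : ∀ x y : C, ‖(V x : E) - V y‖ ≤ ‖(x : E) - y‖)
    {y : ℕ → C} {z : C} (hyz : WeaklyConverges (fun n => (y n : E)) z)
    (hy : Tendsto (fun n => ‖(y n : E) - V (y n)‖) atTop (𝓝 0)) : V z = z := by
  have hg : ∀ ε : {ε : ℝ // 0 < ε}, ∃ δ : {ε : ℝ // 0 < ε}, (δ : ℝ) ≤ ε / 2 ∧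
      ∀ u v w : C, ‖(u : E) - V u‖ ≤ δ → ‖(v : E) - V v‖ ≤ δ →
        (w : E) ∈ segment ℝ (u : E) v → ‖(w : E) - V w‖ ≤ ε := fun ε => by
    obtain ⟨δ, hδ, h1, h2⟩ := exists_pos_almost_fixed_segment hCb hV ε.2
    exact ⟨⟨δ, hδ⟩, h1, h2⟩
  choose g hg1 hg2 using hg
  -- Tolerances chosen so that joining two d (n+1)-almost fixed points by a segment costs only d n.
  set d : ℕ → {ε : ℝ // 0 < ε} := fun n => g^[n] ⟨1, one_pos⟩ with hd
  have hds : ∀ n, d (n + 1) = g (d n) := fun n => Function.iterate_succ_apply' g n _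
  have hdhalf : ∀ n, (d (n + 1) : ℝ) ≤ d n / 2 := fun n => by rw [hds]; exact hg1 _
  have hdpow : ∀ n, (d n : ℝ) ≤ (1 / 2) ^ n := fun n => by
    induction n with
    | zero => simp [hd]
    | succ n ih => rw [pow_succ]; linarith [hdhalf n]
  obtain ⟨φ, hφ, hφd⟩ := extraction_forall_of_eventually'
    (P := fun j n => ‖(y n : E) - V (y n)‖ ≤ d (j + 1))
    (fun j => (eventually_atTop.1 (hy.eventually_le_const (d (j + 1)).2)))
  set v : ℕ → E := fun j => y (φ j) with hv
  have hull : ∀ k J, convexHull ℝ (v '' Set.Icc J (J + k)) ⊆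
      {w | ∃ h : w ∈ C, ‖w - V ⟨w, h⟩‖ ≤ d J} := by
    intro k
    induction k with
    | zero =>
      intro J w hw
      rw [add_zero, Set.Icc_self, Set.image_singleton, convexHull_singleton,
        Set.mem_singleton_iff] at hw
      subst hw
      exact ⟨(y (φ J)).2, (hφd J).trans (by linarith [hdhalf J, (d J).2])⟩
    | succ k ih =>
      intro J w hw
      -- Peel off the first point: the hull of the others is d (J+1)-almost fixed, and the hull is
      -- the union of segments from v J to it.
      have hI : Set.Icc J (J + (k + 1)) = insert J (Set.Icc (J + 1) (J + 1 + k)) := by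
        ext i; simp only [Set.mem_Icc, Set.mem_insert_iff]; omega
      have hne : (v '' Set.Icc (J + 1) (J + 1 + k)).Nonempty := ⟨v (J + 1), J + 1, by simp, rfl⟩
      rw [hI, Set.image_insert_eq, convexHull_insert hne, mem_convexJoin] at hw
      obtain ⟨a, ha, b, hb, hw⟩ := hw
      rw [Set.mem_singleton_iff] at ha
      subst ha
      obtain ⟨hbC, hb⟩ := ih (J + 1) hb
      have hwC : w ∈ C := hCx.segment_subset (y (φ J)).2 hbC hw
      refine ⟨hwC, hg2 (d J) (y (φ J)) ⟨b, hbC⟩ ⟨w, hwC⟩ ?_ ?_ hw⟩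
      · rw [← hds]; exact hφd J
      · rw [← hds]; exact hb
  have hullIci : ∀ J, convexHull ℝ (v '' Set.Ici J) ⊆
      {w | ∃ h : w ∈ C, ‖w - V ⟨w, h⟩‖ ≤ d J} := fun J => by
    refine (convexHull_min ?_ (Directed.convex_iUnion (𝕜 := ℝ)
      (s := fun k => convexHull ℝ (v '' Set.Icc J (J + k))) (Monotone.directed_le fun k l hkl =>
        convexHull_mono (Set.image_mono (Set.Icc_subset_Icc_right (by omega))))
      fun k => convex_convexHull ℝ _)).trans (Set.iUnion_subset fun k => hull k J)
    rintro _ ⟨n, hn, rfl⟩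
    refine Set.mem_iUnion.2 ⟨n - J, subset_convexHull ℝ _ ⟨n, ⟨hn, ?_⟩, rfl⟩⟩
    have : J ≤ n := hn
    omega
  have hvz : WeaklyConverges v z := hyz.comp_tendsto hφ.tendsto_atTop
  have hlim : Tendsto (fun J : ℕ => (1 / 2 : ℝ) ^ J + 2 * (1 / 2 : ℝ) ^ J) atTop
      (𝓝 (0 + 2 * 0)) := by
    have := tendsto_pow_atTop_nhds_zero_of_lt_one (r := (1 / 2 : ℝ)) (by norm_num) (by norm_num)
    exact this.add (this.const_mul 2)
  have hle : ‖(z : E) - V z‖ ≤ 0 + 2 * 0 := by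
    refine ge_of_tendsto' hlim fun J => ?_
    obtain ⟨w, hw, hwz⟩ := Metric.mem_closure_iff.1 (hvz.mem_closure_convexHull J) ((1 / 2) ^ J)
      (by positivity)
    obtain ⟨hwC, hwV⟩ := hullIci J hw
    rw [dist_eq_norm] at hwz
    have e : (z : E) - V z = ((z : E) - w) + (w - V ⟨w, hwC⟩) - ((V z : E) - V ⟨w, hwC⟩) := by
      abel
    rw [e]
    refine (norm_sub_le _ _).trans ?_
    have e2 := norm_add_le ((z : E) - w) (w - V ⟨w, hwC⟩)
    have e3 := hV z ⟨w, hwC⟩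
    simp only at e3
    linarith [hdpow J]
  rw [mul_zero, add_zero, norm_le_zero_iff, sub_eq_zero] at hle
  exact Subtype.ext hle.symm

/-- The Krasnoselskii–Mann iteration is asymptotically regular. -/
theorem tendsto_norm_sub_of_combo {r s : ℕ → E} {θ : ℝ} (h0 : 0 < θ) (h1 : θ < 1)
    (hrs : ∀ n, ‖s n‖ ≤ ‖r n‖) (hr : ∀ n, r (n + 1) = (1 - θ) • r n + θ • s n) :
    Tendsto (fun n => ‖r n - s n‖) atTop (𝓝 0) := by
  have hanti : Antitone fun n => ‖r n‖ := antitone_nat_of_succ_le fun n => by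
    rw [hr]
    refine (norm_add_le _ _).trans ?_
    rw [norm_smul_of_nonneg h0.le, norm_smul_of_nonneg (by linarith)]
    nlinarith [hrs n]
  have hlim := tendsto_atTop_ciInf hanti ⟨0, by rintro _ ⟨n, rfl⟩; exact norm_nonneg _⟩
  have hdiff : Tendsto (fun n => ‖r n‖ - ‖r (n + 1)‖) atTop (𝓝 0) := by
    simpa using hlim.sub (hlim.comp (tendsto_add_atTop_nat 1))
  rw [Metric.tendsto_atTop']
  intro η hη
  obtain ⟨c, hc, h⟩ := exists_pos_norm_combo_le E ‖r 0‖ hη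
  have hpos : 0 < 2 * (θ * (1 - θ)) * c := by
    have : 0 < 1 - θ := by linarith
    positivity
  obtain ⟨N, hN⟩ := eventually_atTop.1 (hdiff.eventually_lt_const hpos)
  refine ⟨N, fun n hn => ?_⟩
  simp only [dist_zero_right, norm_norm]
  by_contra! hcon
  have := h ‖r n‖ (hanti (Nat.zero_le n)) (r n) (s n) le_rfl (hrs n) hcon θ h0.le h1.le
  rw [← hr] at this
  linarith [hN n hn.le]

end NonexpansiveMappings

/-! ### From uniform difference quotients to a Fréchet derivative. -/

section FrechetDifferentiability

variable {E : Type*} [NormedAddCommGroup E] [NormedSpace ℝ E]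

theorem FrechetDifferentiableNorm.differentiableAt_of_norm_eq_one (hE : FrechetDifferentiableNorm E)
    {x : E} (hx : ‖x‖ = 1) : DifferentiableAt ℝ (fun y : E => ‖y‖) x := by
  obtain ⟨g, hg⟩ := hE x hx
  obtain ⟨f, hf1, hfx⟩ := exists_dual_vector ℝ x (by rw [hx]; exact one_ne_zero)
  have hfx1 : f x = 1 := by rw [hfx, hx]; rfl
  -- The norming functional f is a subgradient at x. The left and right difference quotients lie on
  -- opposite sides of f y, so their common limit g y equals f y.
  have hle : ∀ (t : ℝ) (y : E), t * f y ≤ ‖x + t • y‖ - ‖x‖ := fun t y => by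
    have := (le_abs_self _).trans (f.le_of_opNorm_le hf1.le (x + t • y))
    rw [map_add, map_smul, hfx1, smul_eq_mul, one_mul] at this
    linarith
  have hgf : ∀ y : E, ‖y‖ = 1 → g y = f y := fun y hy => by
    have ht := hg.tendsto_at hy
    refine le_antisymm (le_of_tendsto (ht.mono_left (nhdsLT_le_nhdsNE 0)) ?_)
      (ge_of_tendsto (ht.mono_left (nhdsGT_le_nhdsNE 0)) ?_)
    · filter_upwards [self_mem_nhdsWithin] with t (ht : t < 0)
      rw [div_le_iff_of_neg ht, mul_comm]
      exact hle t y
    · filter_upwards [self_mem_nhdsWithin] with t (ht : 0 < t)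
      rw [le_div_iff₀ ht, mul_comm]
      exact hle t y
  suffices HasFDerivAt (fun y : E => ‖y‖) f x from this.differentiableAt
  rw [hasFDerivAt_iff_isLittleO_nhds_zero, Asymptotics.isLittleO_iff]
  intro ε hε
  have hu := Metric.tendstoUniformlyOn_iff.1 hg ε hε
  rw [eventually_nhdsWithin_iff, Metric.eventually_nhds_iff] at hu
  obtain ⟨δ, hδ, hu⟩ := hu
  filter_upwards [Metric.ball_mem_nhds (0 : E) hδ] with v hv
  rcases eq_or_ne v 0 with rfl | hv0
  · simp
  have hvn : 0 < ‖v‖ := norm_pos_iff.2 hv0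
  have hy1 : ‖‖v‖⁻¹ • v‖ = 1 := norm_smul_inv_norm hv0
  have := hu (y := ‖v‖) (by simpa using hv) (by simpa using hv0) _ hy1
  rw [hgf _ hy1, smul_inv_smul₀ hvn.ne', map_smul, smul_eq_mul, dist_comm, Real.dist_eq,
    show (‖x + v‖ - ‖x‖) / ‖v‖ - ‖v‖⁻¹ * f v = (‖x + v‖ - ‖x‖ - f v) / ‖v‖ by field_simp,
    abs_div, abs_of_pos hvn, div_lt_iff₀ hvn] at this
  exact this.le

theorem FrechetDifferentiableNorm.differentiableAt (hE : FrechetDifferentiableNorm E)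
    {x : E} (hx : x ≠ 0) : DifferentiableAt ℝ (fun y : E => ‖y‖) x := by
  rw [differentiableAt_norm_smul (t := ‖x‖⁻¹) (inv_ne_zero (norm_ne_zero_iff.2 hx))]
  exact hE.differentiableAt_of_norm_eq_one (norm_smul_inv_norm hx)

end FrechetDifferentiability

/-! ### Reich's theorem on weak convergence of iterates. -/

section WeakConvergenceOfIterates

theorem exists_tendsto_of_almost_antitone {a : ℕ → ℝ} (h0 : ∀ n, 0 ≤ a n)
    (h : ∀ η > 0, ∃ N, ∀ n ≥ N, ∀ m, a (n + m) ≤ a n + η) : ∃ L, Tendsto a atTop (𝓝 L) := by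
  -- Its infimum is the lower limit of a, the candidate for L.
  set A := {r : ℝ | ∃ᶠ n in atTop, a n ≤ r}
  have hAb : BddBelow A := ⟨0, fun r hr => by
    obtain ⟨n, hn⟩ := hr.exists
    exact (h0 n).trans hn⟩
  have hAn : A.Nonempty := by
    obtain ⟨N, hN⟩ := h 1 one_pos
    refine ⟨a N + 1, Eventually.frequently ?_⟩
    filter_upwards [eventually_ge_atTop N] with n hn
    simpa [Nat.add_sub_cancel' hn] using hN N le_rfl (n - N)
  refine ⟨sInf A, Metric.tendsto_atTop'.2 fun η hη => ?_⟩
  obtain ⟨r, hr, hrlt⟩ := exists_lt_of_csInf_lt hAn (show sInf A < sInf A + η / 2 by linarith)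
  obtain ⟨N, hN⟩ := h (η / 2) (half_pos hη)
  obtain ⟨n, hn, hnr⟩ := (frequently_atTop.1 hr) N
  have hlow : ∀ᶠ k in atTop, sInf A - η < a k := by
    by_contra hcon
    have : sInf A - η ∈ A := (not_eventually.1 hcon).mono fun k hk => not_lt.1 hk
    linarith [csInf_le hAb this]
  obtain ⟨N', hN'⟩ := eventually_atTop.1 hlow
  refine ⟨max n N', fun k hk => ?_⟩
  have hk1 : n ≤ k := (le_max_left _ _).trans hk.le
  have h1 := hN n hn (k - n)
  rw [Nat.add_sub_cancel' hk1] at h1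
  have h2 := hN' k ((le_max_right _ _).trans hk.le)
  rw [Real.dist_eq, abs_lt]
  constructor <;> linarith

theorem norm_iterate_sub_le {E : Type*} [NormedAddCommGroup E] {C : Set E} {S : C → C}
    (hS : ∀ x y : C, ‖(S x : E) - S y‖ ≤ ‖(x : E) - y‖) (m : ℕ) (x y : C) :
    ‖(S^[m] x : E) - S^[m] y‖ ≤ ‖(x : E) - y‖ := by
  induction m with
  | zero => exact le_rfl
  | succ m ih =>
    rw [Function.iterate_succ_apply', Function.iterate_succ_apply']
    exact (hS _ _).trans ih

variable {E : Type*} [NormedAddCommGroup E] [NormedSpace ℝ E] [UniformConvexSpace E]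

/-- Late in the sequence, each S^m nearly preserves the distance from x_n to p, hence is nearly
affine on that segment. It carries t x_n + (1-t)p close to t x_{n+m} + (1-t)p without moving it away
from q. Bruck's δ does not depend on the map, so it serves all m at once. -/
theorem exists_tendsto_norm_combo_sub {C : Set E} (hCb : Bornology.IsBounded C)
    (hCx : Convex ℝ C) {S : C → C} (hS : ∀ x y : C, ‖(S x : E) - S y‖ ≤ ‖(x : E) - y‖)
    {x : ℕ → C} (hx : ∀ n, x (n + 1) = S (x n)) {p q : C} (hp : S p = p) (hq : S q = q)
    {t : ℝ} (h0 : 0 < t) (h1 : t < 1) :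
    ∃ L, Tendsto (fun n => ‖t • (x n : E) + (1 - t) • (p : E) - q‖) atTop (𝓝 L) := by
  obtain ⟨D, hD⟩ := Metric.isBounded_iff.1 hCb
  have hit : ∀ m n, S^[m] (x n) = x (n + m) := fun m n => by
    induction m with
    | zero => rfl
    | succ m ih => rw [Function.iterate_succ_apply', ih, ← hx, add_assoc]
  have hanti : Antitone fun n => ‖(x n : E) - p‖ := antitone_nat_of_succ_le fun n => by
    have := hS (x n) p
    rwa [hp, ← hx] at this
  have hlim := tendsto_atTop_ciInf hanti ⟨0, by rintro _ ⟨n, rfl⟩; exact norm_nonneg _⟩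
  refine exists_tendsto_of_almost_antitone (fun n => norm_nonneg _) fun η hη => ?_
  obtain ⟨δ, hδ, h⟩ := exists_pos_norm_map_combo_sub_le E D hη
  set R := ⨅ n, ‖(x n : E) - p‖
  obtain ⟨N, hN⟩ := eventually_atTop.1
    (hlim.eventually_lt_const (show R < R + δ by linarith))
  refine ⟨N, fun n hn m => ?_⟩
  have hpm : S^[m] p = p := Function.iterate_fixed hp m
  have hqm : S^[m] q = q := Function.iterate_fixed hq m
  have hRle : R ≤ ‖(x (n + m) : E) - p‖ := hanti.le_of_tendsto hlim (n + m)
  have hw : t • (x n : E) + (1 - t) • (p : E) ∈ C :=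
    hCx (x n).2 p.2 h0.le (by linarith) (by ring)
  have key := h C S^[m] (norm_iterate_sub_le hS m) (x n) p
    (by simpa [dist_eq_norm] using hD (x n).2 p.2)
    (by rw [hit, hpm]; linarith [hN n hn]) t h0 h1 ⟨_, hw⟩ rfl
  have h2 := norm_iterate_sub_le hS m ⟨_, hw⟩ q
  rw [hit, hpm] at key
  rw [hqm] at h2
  set w := S^[m] ⟨_, hw⟩
  have e : t • (x (n + m) : E) + (1 - t) • (p : E) - q
      = ((w : E) - q) - ((w : E) - (t • (x (n + m) : E) + (1 - t) • (p : E))) := by abel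
  rw [e]
  refine (norm_sub_le _ _).trans ?_
  simp only at h2
  linarith

theorem eq_of_weakly_subseq_limits (hE : FrechetDifferentiableNorm E) {C : Set E}
    (hCb : Bornology.IsBounded C) (hCx : Convex ℝ C) {S : C → C}
    (hS : ∀ x y : C, ‖(S x : E) - S y‖ ≤ ‖(x : E) - y‖)
    {x : ℕ → C} (hx : ∀ n, x (n + 1) = S (x n)) {p q : C} (hp : S p = p) (hq : S q = q)
    {φ ψ : ℕ → ℕ} (hφ : Tendsto φ atTop atTop) (hψ : Tendsto ψ atTop atTop)
    (hxp : WeaklyConverges (fun n => (x (φ n) : E)) p)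
    (hxq : WeaklyConverges (fun n => (x (ψ n) : E)) q) : p = q := by
  by_contra hne
  have hh : (p : E) - q ≠ 0 := sub_ne_zero.2 fun h => hne (Subtype.ext h)
  have hdiff := hE.differentiableAt hh
  set f := fderiv ℝ (fun y : E => ‖y‖) ((p : E) - q) with hf
  have hfh : f ((p : E) - q) = ‖(p : E) - q‖ := hdiff.fderiv_norm_self
  obtain ⟨D, hD⟩ := Metric.isBounded_iff.1 hCb
  have hD0 : 0 ≤ D := dist_nonneg.trans (hD p.2 p.2)
  have hzero : ‖(p : E) - q‖ ≤ 0 := by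
    refine le_of_forall_pos_le_add fun ε hε => ?_
    have hε' : 0 < ε / (2 * (D + 1)) := by positivity
    have hlo := (hasFDerivAt_iff_isLittleO_nhds_zero.1 hdiff.hasFDerivAt)
    rw [Asymptotics.isLittleO_iff] at hlo
    obtain ⟨δ, hδ, hball⟩ := Metric.eventually_nhds_iff.1 (hlo hε')
    -- Keeps t below 1 and every t(x_n - p) within the δ-ball of the first-order expansion.
    set t := min (1 / 2) (δ / (2 * (D + 1))) with ht
    have ht0 : 0 < t := by positivity
    have ht1 : t < 1 := (min_le_left _ _).trans_lt (by norm_num)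
    have htD : t * (D + 1) < δ := by
      have := mul_le_mul_of_nonneg_right (min_le_right (1 / 2) (δ / (2 * (D + 1))))
        (show 0 ≤ D + 1 by linarith)
      rw [← ht, show δ / (2 * (D + 1)) * (D + 1) = δ / 2 by field_simp] at this
      linarith
    obtain ⟨L, hL⟩ := exists_tendsto_norm_combo_sub hCb hCx hS hx hp hq ht0 ht1
    have hest : ∀ n, |‖t • (x n : E) + (1 - t) • (p : E) - q‖ - ‖(p : E) - q‖
        - t * f ((x n : E) - p)| ≤ t * (ε / 2) := fun n => by
      have hxn : ‖(x n : E) - p‖ ≤ D := by simpa [dist_eq_norm] using hD (x n).2 p.2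
      have hn : ‖t • ((x n : E) - p)‖ ≤ t * (D + 1) := by
        rw [norm_smul_of_nonneg ht0.le]
        exact mul_le_mul_of_nonneg_left (by linarith) ht0.le
      have := hball (y := t • ((x n : E) - p)) (by rw [dist_zero_right]; linarith)
      rw [← hf, map_smul, smul_eq_mul, Real.norm_eq_abs, show (p : E) - q + t • ((x n : E) - p)
        = t • (x n : E) + (1 - t) • (p : E) - q by module] at this
      refine this.trans ((mul_le_mul_of_nonneg_left hn hε'.le).trans_eq ?_)
      field_simp
    have hpass : ∀ (χ : ℕ → ℕ) (w : E), Tendsto χ atTop atTop →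
        WeaklyConverges (fun n => (x (χ n) : E)) w →
        |L - ‖(p : E) - q‖ - t * f (w - p)| ≤ t * (ε / 2) := fun χ w hχ hw => by
      have hfw : Tendsto (fun n => f ((x (χ n) : E) - p)) atTop (𝓝 (f (w - p))) := by
        simp only [map_sub]
        exact (weaklyConverges_iff.1 hw f).sub_const _
      exact le_of_tendsto' (((hL.comp hχ).sub_const _).sub (hfw.const_mul t)).abs
        fun n => hest (χ n)
    -- The linear term tends to 0 along φ and to -t‖p - q‖ along ψ, yet both approximate the same L
    -- - ‖p - q‖ within tε/2.
    have hP := hpass φ p hφ hxp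
    have hQ := hpass ψ q hψ hxq
    have e : f ((q : E) - p) = -‖(p : E) - q‖ := by rw [← neg_sub, map_neg, hfh]
    rw [sub_self, map_zero, mul_zero, sub_zero, abs_le] at hP
    rw [e, abs_le] at hQ
    have : t * ‖(p : E) - q‖ ≤ t * ε := by linarith [hP.1, hP.2, hQ.1, hQ.2]
    rw [zero_add]
    exact le_of_mul_le_mul_left this ht0
  exact hh (norm_le_zero_iff.1 hzero)

/-- Reich's theorem: asymptotically regular iterates of a nonexpansive mapping converge weakly
to a fixed point. -/
theorem exists_fixedPoint_weaklyConverges_iterate [CompleteSpace E]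
    (hE : FrechetDifferentiableNorm E) {C : Set E}
    (hCb : Bornology.IsBounded C) (hCc : IsClosed C) (hCx : Convex ℝ C) {S : C → C}
    (hS : ∀ x y : C, ‖(S x : E) - S y‖ ≤ ‖(x : E) - y‖)
    {x : ℕ → C} (hx : ∀ n, x (n + 1) = S (x n))
    (hreg : Tendsto (fun n => ‖(x n : E) - S (x n)‖) atTop (𝓝 0)) :
    ∃ z : C, S z = z ∧ WeaklyConverges (fun n => (x n : E)) z := by
  obtain ⟨M, hM⟩ := hCb.exists_norm_le
  have hfix : ∀ (φ : ℕ → ℕ) (w : C), Tendsto φ atTop atTop →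
      WeaklyConverges (fun n => (x (φ n) : E)) w → S w = w := fun φ w hφ hw =>
    hw.map_eq_self hCb hCx hS (hreg.comp hφ)
  obtain ⟨z, φ, hφ, hz⟩ := exists_subseq_weaklyConverges (fun n => (x n : E))
    fun n => hM _ (x n).2
  lift z to C using hz.mem_of_isClosed_of_convex hCc hCx fun n => (x (φ n)).2
  have hSz := hfix φ z hφ.tendsto_atTop hz
  refine ⟨z, hSz, weaklyConverges_of_subseq_unique _ (fun n => hM _ (x n).2) z
    fun w ψ hψ hw => ?_⟩
  lift w to C using hw.mem_of_isClosed_of_convex hCc hCx fun n => (x (ψ n)).2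
  exact congrArg Subtype.val (eq_of_weakly_subseq_limits hE hCb hCx hS hx (hfix ψ w hψ hw) hSz hψ
    hφ.tendsto_atTop hw hz)

end WeakConvergenceOfIterates

/-! ### Common fixed points of the semigroup. -/

section CommonFixedPoints

variable {E : Type*} [NormedAddCommGroup E]

/-- A common fixed point of `T α` and `T β`, with `α / β` irrational, is a fixed point of the
whole semigroup. -/
theorem IsNonexpansiveSemigroup.map_eq_self_of_irrational {τ : TopologicalSpace E}
    (hτ : @T2Space E τ) {C : Set E} {T : ℝ≥0 → C → C} (hT : IsNonexpansiveSemigroup τ C T)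
    {α β : ℝ≥0} (hαβ : Irrational ((α : ℝ) / (β : ℝ))) {z : C} (hα : T α z = z) (hβ : T β z = z)
    (t : ℝ≥0) : T t z = z := by
  have hadd : ∀ s t, T (s + t) z = T s (T t z) := fun s t => congrFun (hT.map_add s t) z
  have h0 : T 0 z = z := by
    have := hadd 0 α
    rwa [zero_add, hα, eq_comm] at this
  have hnsmul : ∀ a : ℝ≥0, T a z = z → ∀ n : ℕ, T (n • a) z = z := fun a ha n => by
    induction n with
    | zero => rwa [zero_smul]
    | succ n ih => rw [succ_nsmul, hadd, ha, ih]
  have hcomb : ∀ m n : ℕ, T (m • α + n • β) z = z := fun m n => by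
    rw [hadd, hnsmul β hβ, hnsmul α hα]
  set G := AddSubgroup.closure {(α : ℝ), (β : ℝ)}
  have hG : Dense (G : Set ℝ) := dense_addSubgroupClosure_pair_iff.2 hαβ
  have hfix : ∀ g : ℝ≥0, (g : ℝ) ∈ G → T g z = z := fun g hg => by
    obtain ⟨m, n, hmn⟩ := AddSubgroup.mem_closure_pair.1 hg
    -- Times cannot be negative, so the negative parts of m and n are moved to the left. Both
    -- nonnegative combinations fix z, hence so does g.
    have e : g + ((-m).toNat • α + (-n).toNat • β) = m.toNat • α + n.toNat • β := by
      rw [← NNReal.coe_inj]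
      push_cast
      rw [← hmn]
      have h1 : (m : ℝ) = (m.toNat : ℝ) - ((-m).toNat : ℝ) := by
        exact_mod_cast (Int.toNat_sub_toNat_neg m).symm
      have h2 : (n : ℝ) = (n.toNat : ℝ) - ((-n).toNat : ℝ) := by
        exact_mod_cast (Int.toNat_sub_toNat_neg n).symm
      simp only [zsmul_eq_mul, nsmul_eq_mul]
      rw [h1, h2]
      ring
    have := hadd g ((-m).toNat • α + (-n).toNat • β)
    rwa [e, hcomb, hcomb, eq_comm] at this
  have hclosed : IsClosed {s : ℝ≥0 | (T s z : E) = z} :=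
    @isClosed_eq E ℝ≥0 τ _ hτ _ _ (hT.continuous_orbit z) (@continuous_const _ _ _ τ _)
  have hdense : Dense ((fun s : ℝ≥0 => (s : ℝ)) ⁻¹' (G : Set ℝ)) := by
    refine Metric.dense_iff.2 fun s r hr => ?_
    obtain ⟨g, hg, hgG⟩ := hG.exists_mem_open (isOpen_Ioo (a := (s : ℝ)) (b := s + r))
      ⟨s + r / 2, by constructor <;> linarith⟩
    lift g to ℝ≥0 using s.2.trans hgG.1.le
    refine ⟨g, ?_, hg⟩
    rw [Metric.mem_ball, NNReal.dist_eq, abs_lt]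
    have h1 := hgG.1
    have h2 := hgG.2
    constructor <;> linarith
  have hsub : (fun s : ℝ≥0 => (s : ℝ)) ⁻¹' (G : Set ℝ) ⊆ {s : ℝ≥0 | (T s z : E) = z} :=
    fun s hs => congrArg Subtype.val (hfix s hs)
  exact Subtype.ext (closure_minimal hsub hclosed (hdense t))

variable [NormedSpace ℝ E] [UniformConvexSpace E] [CompleteSpace E]

/-- A nonexpansive semigroup on a nonempty bounded closed convex set has a common fixed point,
namely the asymptotic centre of any orbit. -/
theorem exists_common_fixedPoint_of_semigroup {C : Set E} (hCb : Bornology.IsBounded C)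
    (hCc : IsClosed C) (hCx : Convex ℝ C) {T : ℝ≥0 → C → C}
    (hadd : ∀ s t, T (s + t) = T s ∘ T t)
    (hnonexp : ∀ t (x y : C), ‖(T t x : E) - T t y‖ ≤ ‖(x : E) - y‖) (u : C) : ∃ p : C, ∀ t, T t p = p := by
  -- R, the infimum of the admissible r, is the asymptotic radius of the orbit of u.
  set P : C → ℝ → Prop := fun y r => ∀ᶠ t in atTop, ‖(T t u : E) - y‖ ≤ r with hP
  set A := {r : ℝ | ∃ y, P y r} with hA
  obtain ⟨D, hD⟩ := Metric.isBounded_iff.1 hCb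
  have hAb : BddBelow A := ⟨0, by
    rintro r ⟨y, hy⟩
    obtain ⟨t, ht⟩ := hy.exists
    exact (norm_nonneg _).trans ht⟩
  have hAn : A.Nonempty := ⟨D, u, Eventually.of_forall fun t => by
    simpa [dist_eq_norm] using hD (T t u).2 u.2⟩
  set R := sInf A
  have hinv : ∀ y r s, P y r → P (T s y) r := fun y r s hy => by
    obtain ⟨a, ha⟩ := eventually_atTop.1 hy
    refine eventually_atTop.2 ⟨a + s, fun t ht => ?_⟩
    have hst : s ≤ t := le_add_self.trans ht
    have e : T t u = T s (T (t - s) u) := by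
      rw [← Function.comp_apply (f := T s), ← hadd, add_tsub_cancel_of_le hst]
    rw [e]
    exact (hnonexp s _ _).trans (ha _ (le_tsub_of_add_le_right ht))
  have hclose : ∀ η > 0, ∃ δ > 0, ∀ y y', P y (R + δ) → P y' (R + δ) → ‖(y : E) - y'‖ < η := by
    intro η hη
    obtain ⟨δ, hδ, h⟩ := exists_pos_norm_sub_lt E R hη
    refine ⟨δ, hδ, fun y y' hy hy' => ?_⟩
    have hm : (1 / 2 : ℝ) • (y : E) + (1 / 2 : ℝ) • (y' : E) ∈ C :=
      hCx y.2 y'.2 (by norm_num) (by norm_num) (by norm_num)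
    have hnot : ¬ P ⟨_, hm⟩ (R - δ) := fun hcon => by
      have := csInf_le hAb (show R - δ ∈ A from ⟨_, hcon⟩)
      linarith
    -- The midpoint cannot have radius R - δ, so at some late time it is farther than that from the
    -- orbit while y and y' are both within R + δ.
    obtain ⟨t, ht, hty, hty'⟩ := ((not_eventually.1 hnot).and_eventually (hy.and hy')).exists
    have := h ((T t u : E) - y') ((T t u : E) - y) hty' hty (by
      rw [show (1 / 2 : ℝ) • ((T t u : E) - y') + (1 / 2 : ℝ) • ((T t u : E) - y)
        = (T t u : E) - ((1 / 2 : ℝ) • (y : E) + (1 / 2 : ℝ) • (y' : E)) by module]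
      exact (not_le.1 ht).le)
    rwa [sub_sub_sub_cancel_left] at this
  have hex : ∀ n : ℕ, ∃ y, P y (R + 1 / ((n : ℝ) + 1)) := fun n => by
    obtain ⟨r, ⟨y, hy⟩, hr⟩ := exists_lt_of_csInf_lt hAn
      (show sInf A < R + 1 / ((n : ℝ) + 1) by
        have : (0 : ℝ) < 1 / ((n : ℝ) + 1) := Nat.one_div_pos_of_nat
        linarith)
    exact ⟨y, hy.mono fun t ht => ht.trans hr.le⟩
  choose y hy using hex
  have hev : ∀ δ > 0, ∀ᶠ n in atTop, P (y n) (R + δ) := fun δ hδ => by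
    filter_upwards [(tendsto_one_div_add_atTop_nhds_zero_nat (𝕜 := ℝ)).eventually_lt_const hδ]
      with n hn
    exact (hy n).mono fun t ht => ht.trans (by linarith)
  have hcau : CauchySeq fun n => (y n : E) := Metric.cauchySeq_iff.2 fun η hη => by
    obtain ⟨δ, hδ, h⟩ := hclose η hη
    obtain ⟨N, hN⟩ := eventually_atTop.1 (hev δ hδ)
    exact ⟨N, fun m hm n hn => by rw [dist_eq_norm]; exact h _ _ (hN m hm) (hN n hn)⟩
  obtain ⟨z, hz⟩ := cauchySeq_tendsto_of_complete hcau
  lift z to C using hCc.mem_of_tendsto hz (Eventually.of_forall fun n => (y n).2)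
  refine ⟨z, fun s => Subtype.ext (eq_of_forall_dist_le fun ε hε => ?_)⟩
  obtain ⟨δ, hδ, h⟩ := hclose (ε / 3) (by linarith)
  obtain ⟨n, hn, hnz⟩ := ((hev δ hδ).and
    (Metric.tendsto_nhds.1 hz (ε / 3) (by linarith))).exists
  rw [dist_eq_norm] at hnz ⊢
  -- T s maps a near-centre to a near-centre, and near-centres are close together.
  have h1 := h _ _ (hinv _ _ s hn) hn
  have h2 := hnonexp s z (y n)
  rw [norm_sub_rev (z : E)] at h2
  have e : (T s z : E) - z
      = ((T s z : E) - T s (y n)) + ((T s (y n) : E) - y n) + ((y n : E) - z) := by abel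
  rw [e]
  refine norm_add₃_le.trans ?_
  linarith

end CommonFixedPoints

/-! ### Fixed points of the averaged map and the main theorem. -/

/-- Group a with v: if they differ, strict convexity makes their average strictly shorter than v,
and b is too short to compensate. -/
theorem eq_of_combo_eq_self {E : Type*} [NormedAddCommGroup E] [NormedSpace ℝ E]
    [StrictConvexSpace ℝ E] {κ l : ℝ} (hκ : 0 < κ) (hl : 0 < l) (hκl : κ + l < 1) {a b v : E}
    (ha : ‖a‖ ≤ ‖v‖) (hb : ‖b‖ ≤ ‖v‖) (h : v = κ • a + l • b + (1 - κ - l) • v) : a = v := by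
  by_contra hne
  have hlt := norm_combo_lt_of_ne ha le_rfl hne (a := κ / (1 - l)) (b := (1 - κ - l) / (1 - l))
    (div_pos hκ (by linarith)) (div_pos (by linarith) (by linarith))
    (by rw [← add_div]; exact (div_eq_one_iff_eq (by linarith)).2 (by ring))
  have hl1 : 0 < 1 - l := by linarith
  have e : v = (1 - l) • ((κ / (1 - l)) • a + ((1 - κ - l) / (1 - l)) • v) + l • b := by
    rw [smul_add, smul_smul, smul_smul, mul_div_cancel₀ _ hl1.ne', mul_div_cancel₀ _ hl1.ne']
    nth_rewrite 1 [h]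
    abel
  have : ‖v‖ < ‖v‖ := by
    nth_rewrite 1 [e]
    refine (norm_add_le _ _).trans_lt ?_
    rw [norm_smul_of_nonneg hl1.le, norm_smul_of_nonneg hl.le]
    nlinarith
  exact lt_irrefl _ this

theorem norm_combo₃_le {E : Type*} [NormedAddCommGroup E] [NormedSpace ℝ E] {κ l M : ℝ}
    (hκ : 0 ≤ κ) (hl : 0 ≤ l) (hκl : κ + l ≤ 1) {a b v : E} (ha : ‖a‖ ≤ M) (hb : ‖b‖ ≤ M)
    (hv : ‖v‖ ≤ M) : ‖κ • a + l • b + (1 - κ - l) • v‖ ≤ M := by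
  have hm : 0 ≤ 1 - κ - l := by linarith
  refine norm_add₃_le.trans ?_
  rw [norm_smul_of_nonneg hκ, norm_smul_of_nonneg hl, norm_smul_of_nonneg hm]
  nlinarith [mul_le_mul_of_nonneg_left ha hκ, mul_le_mul_of_nonneg_left hb hl,
    mul_le_mul_of_nonneg_left hv hm]

theorem theorem5p3 {E : Type*} [NormedAddCommGroup E] [NormedSpace ℝ E] [CompleteSpace E]
    [UniformConvexSpace E] (hE : FrechetDifferentiableNorm E)
    (C : Set E) (hCb : Bornology.IsBounded C) (hCc : IsClosed C) (hCx : Convex ℝ C)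
    (T : ℝ≥0 → C → C)
    (τ : TopologicalSpace E) (hτ : @T2Space E τ) (hT : IsNonexpansiveSemigroup τ C T)
    (α β : ℝ≥0) (hα : 0 < α) (hβ : 0 < β) (hαβ : Irrational ((α : ℝ) / (β : ℝ)))
    (κ l : ℝ) (hκ : 0 < κ) (hl : 0 < l) (hκl : κ + l < 1)
    (x : ℕ → C)
    (hx : ∀ n : ℕ, (x (n + 1) : E) =
      κ • (T α (x n) : E) + l • (T β (x n) : E) + (1 - κ - l) • (x n : E)) :
    ∃ z : C, (∀ t : ℝ≥0, T t z = z) ∧ WeaklyConverges (fun n => (x n : E)) (z : E) := by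
  obtain ⟨p, hp⟩ := exists_common_fixedPoint_of_semigroup hCb hCc hCx hT.map_add
    hT.nonexpansive (x 0)
  have hmem : ∀ y : C, κ • (T α y : E) + l • (T β y : E) + (1 - κ - l) • (y : E) ∈ C := fun y => by
    have h1 : 0 < κ + l := by linarith
    have h2 := hCx (T α y).2 (T β y).2 (div_nonneg hκ.le h1.le) (div_nonneg hl.le h1.le)
      (by rw [← add_div, div_self h1.ne'])
    have h3 := hCx h2 y.2 h1.le (show 0 ≤ 1 - κ - l by linarith) (by ring)
    rwa [smul_add, smul_smul, smul_smul, mul_div_cancel₀ _ h1.ne', mul_div_cancel₀ _ h1.ne'] at h3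
  set S : C → C := fun y => ⟨_, hmem y⟩ with hSdef
  have hS : ∀ y w : C, ‖(S y : E) - S w‖ ≤ ‖(y : E) - w‖ := fun y w => by
    have e : (S y : E) - S w = κ • ((T α y : E) - T α w) + l • ((T β y : E) - T β w)
        + (1 - κ - l) • ((y : E) - w) := by
      simp only [hSdef]
      module
    rw [e]
    exact norm_combo₃_le hκ.le hl.le hκl.le (hT.nonexpansive α y w) (hT.nonexpansive β y w) le_rfl
  have hfix : ∀ (t : ℝ≥0) (y : C), ‖(T t y : E) - p‖ ≤ ‖(y : E) - p‖ := fun t y => by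
    simpa only [hp t] using hT.nonexpansive t y p
  have hθ : 0 < κ + l := by linarith
  -- The weighted average of the two images measured from p, so that x_n - p follows a
  -- Krasnoselskii–Mann iteration with θ = κ + l.
  set s : ℕ → E := fun n => (κ / (κ + l)) • ((T α (x n) : E) - p)
    + (l / (κ + l)) • ((T β (x n) : E) - p) with hs
  have hsmul : ∀ n, (κ + l) • s n = κ • ((T α (x n) : E) - p) + l • ((T β (x n) : E) - p) :=
    fun n => by
      rw [hs, smul_add, smul_smul, smul_smul, mul_div_cancel₀ _ hθ.ne', mul_div_cancel₀ _ hθ.ne']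
  have hstep := tendsto_norm_sub_of_combo (r := fun n => (x n : E) - p) (s := s) hθ hκl
    (fun n => by
      refine (norm_add_le _ _).trans ?_
      rw [norm_smul_of_nonneg (by positivity), norm_smul_of_nonneg (by positivity)]
      have h1 := mul_le_mul_of_nonneg_left (hfix α (x n)) (show 0 ≤ κ / (κ + l) by positivity)
      have h2 := mul_le_mul_of_nonneg_left (hfix β (x n)) (show 0 ≤ l / (κ + l) by positivity)
      have h3 : κ / (κ + l) + l / (κ + l) = 1 := by rw [← add_div, div_self hθ.ne']
      calc _ ≤ (κ / (κ + l) + l / (κ + l)) * ‖(x n : E) - p‖ := by linarith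
        _ = ‖(x n : E) - p‖ := by rw [h3, one_mul])
    (fun n => by rw [hsmul, hx]; module)
  have hreg : Tendsto (fun n => ‖(x n : E) - S (x n)‖) atTop (𝓝 0) := by
    have := hstep.const_mul (κ + l)
    rw [mul_zero] at this
    refine this.congr fun n => ?_
    rw [← norm_smul_of_nonneg hθ.le, smul_sub, hsmul]
    congr 1
    simp only [hSdef]
    module
  obtain ⟨z, hz, hxz⟩ := exists_fixedPoint_weaklyConverges_iterate hE hCb hCc hCx hS
    (fun n => Subtype.ext (hx n)) hreg
  have hz' : (z : E) = κ • (T α z : E) + l • (T β z : E) + (1 - κ - l) • (z : E) :=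
    (congrArg Subtype.val hz).symm
  have hcombo : (z : E) - p = κ • ((T α z : E) - p) + l • ((T β z : E) - p)
      + (1 - κ - l) • ((z : E) - p) := by
    nth_rewrite 1 [hz']
    module
  have hα' : T α z = z := Subtype.ext (sub_left_injective
    (eq_of_combo_eq_self hκ hl hκl (hfix α z) (hfix β z) hcombo))
  have hβ' : T β z = z := Subtype.ext (sub_left_injective
    (eq_of_combo_eq_self hl hκ (by linarith) (hfix β z) (hfix α z) (by
      rw [add_comm (l • _), sub_right_comm]
      exact hcombo)))
  exact ⟨z, hT.map_eq_self_of_irrational hτ hαβ hα' hβ', hxz⟩
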